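/- Let $S\subset\mathbb{R}^{N+1}$ be a smooth non-degenerate hypersurface, and let $S_1,S_2\subset S$ be (parameterized) open pieces of $S$, with affine normal fields $\xi_i$, Blaschke metrics $h_i$ and conormal maps $\nu_i$: here $D_XY=\nabla_XY+h_i(X,Y)\xi_i$ for tangent fields $X,Y$, the field $\xi_i$ is one of the two opposite transversal fields whose induced volume form $\theta=[\cdot,\dots,\cdot,\xi_i]$ is $\nabla$-parallel and equals, up to orientation, the volume form of $h_i$, and $\nu_i(p)$ is the linear functional with $\nu_i(p)(\xi_i)=1$ that vanishes on $T_pS_i$. Let $p_1\in S_1$, $p_2\in S_2$ have transversal tangent spaces, and put $M=\frac{p_1+p_2}{2}$, $C=\frac{p_1-p_2}{2}$ and $$F(p_1,p_2,X)=\bigl(\nu_2(C)\,\nu_1+\nu_1(C)\,\nu_2\bigr)(X-M),\qquad X\in\mathbb{R}^{N+1}.$$ Assume that $S$ is convex (it lies on one side of each of its tangent hyperplanes) or, more generally, that $S$ is locally convex (near each of its points it lies on one side of the tangent hyperplane there) and $M$ does not lie in both affine tangent hyperplanes $p_1+T_{p_1}S_1$, $p_2+T_{p_2}S_2$. Let $Z_1,\dots,Z_{N-1}$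 be a basis of $T_{p_1}S_1\cap T_{p_2}S_2$, and for $i=1,2$ let $Y_i\in T_{p_i}S_i$ be a non-zero vector that is $h_i$-orthogonal to all $Z_j$. Write $F_{p_i}(p_1,p_2,X)(W)$ for the derivative of $F$ with respect to $p_i$ in the direction $W\in T_{p_i}S_i$, the other point and $X$ being fixed, and consider the system $$F=0,\quad F_{p_1}(Y_1)=0,\quad F_{p_2}(Y_2)=0,\quad F_{p_1}(Z_j)=0,\quad F_{p_2}(Z_j)=0\quad(1\le j\le N-1)\qquad(*)$$ for $X$, at $(p_1,p_2,X)$. It is equivalent to $F=0$, $F_{p_1}=0$, $F_{p_2}=0$. Put $$\lambda=\left(\frac{\nu_1(Y_2)^2}{\nu_2(Y_1)^2}\,\frac{h_1(Y_1,Y_1)}{h_2(Y_2,Y_2)}\right)^{1/3}\ \text{(real cube root)},\qquad b=-\frac{h_1(Y_1,Y_1)}{\nu_2(Y_1)}.$$ If $C,Y_1,Y_2$ are coplanar (that is, $C\in\operatorname{span}\{Y_1,Y_2\}$) and $\nu_1(C)=-\lambda\,\nu_2(C)$, then there is a unique $A\in\mathbb{R}$ with $$C=A\left(Y_1-\frac{\lambda\,\nu_2(Y_1)}{\nu_1(Y_2)}\,Y_2\right).$$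 The system $(*)$ has a solution $X$ if and only if $C,Y_1,Y_2$ are coplanar, $\nu_1(C)=-\lambda\,\nu_2(C)$, and $\lambda+4Ab\neq0$ for this $A$. In that case the solution is unique, and it is given by $$X-M=B\left(Y_1+\frac{\lambda\,\nu_2(Y_1)}{\nu_1(Y_2)}\,Y_2\right),\qquad B=-\frac{\lambda A}{\lambda+4Ab}.$$ -/

import Mathlib

open scoped ContDiff Topology

noncomputable section

namespace EMH

/-- The real affine space of dimension `n`, with its canonical coordinates. -/
abbrev V (n : ℕ) : Type := Fin n → ℝ

/-- The standard volume form `[v₀, …, v_N]` of `ℝ^(N+1)`. -/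
def vol {N : ℕ} (v : Fin (N + 1) → V (N + 1)) : ℝ :=
  (Matrix.of v).det

/-- `[X₁, …, X_N, ξ]`. -/
def volSnoc {N : ℕ} (X : Fin N → V (N + 1)) (ξ : V (N + 1)) : ℝ :=
  vol (Fin.snoc (α := fun _ => V (N + 1)) X ξ)

/-- `φ : U → ℝ^(N+1)` is a smooth parameterization of a relatively open part of `S`. -/
structure IsParam {N : ℕ} (S : Set (V (N + 1))) (φ : V N → V (N + 1)) (U : Set (V N)) :
    Prop where
  isOpen : IsOpen U
  smooth : ContDiffOn ℝ ∞ φ U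
  immersion : ∀ u ∈ U, Function.Injective (fderiv ℝ φ u)
  embedding : Topology.IsEmbedding (U.domRestrict φ)
  relOpen : ∃ W : Set (V (N + 1)), IsOpen W ∧ φ '' U = S ∩ W

/-- `S` is a smooth (embedded) hypersurface of `ℝ^(N+1)`. -/
def IsHypersurface {N : ℕ} (S : Set (V (N + 1))) : Prop :=
  ∀ p ∈ S, ∃ φ U, IsParam S φ U ∧ p ∈ φ '' U

/-- The tangent space at `φ u`. -/
def tangentSpace {N : ℕ} (φ : V N → V (N + 1)) (u : V N) : Submodule ℝ (V (N + 1)) :=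
  LinearMap.range (fderiv ℝ φ u : V N →ₗ[ℝ] V (N + 1))

/-- The second derivative `D_v D_w φ`. -/
def secondDeriv {N : ℕ} (φ : V N → V (N + 1)) (u v w : V N) : V (N + 1) :=
  fderiv ℝ (fderiv ℝ φ) u v w

/-- The coordinate frame of the tangent space at `φ u`. -/
def coordFrame {N : ℕ} (φ : V N → V (N + 1)) (u : V N) : Fin N → V (N + 1) :=
  fun i => fderiv ℝ φ u (Pi.single i 1)

/-- The functional `X ↦ [∂₁φ, …, ∂_Nφ, X]`. -/
def frameDet {N : ℕ} (φ : V N → V (N + 1)) (u : V N) : V (N + 1) →ₗ[ℝ] ℝ :=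
  (Matrix.detRowAlternating (R := ℝ) (n := Fin (N + 1))).toMultilinearMap.toLinearMap
    (Fin.snoc (α := fun _ => V (N + 1)) (coordFrame φ u) 0) (Fin.last N)

theorem frameDet_apply {N : ℕ} (φ : V N → V (N + 1)) (u : V N) (X : V (N + 1)) :
    frameDet φ u X = volSnoc (coordFrame φ u) X := by
  simp only [frameDet, MultilinearMap.toLinearMap_apply, Fin.update_snoc_last]
  rfl

/-- The functional `ν` with `ν(ξ) = 1` and `ν = 0` on the tangent space at `φ u`, for a vector
`ξ` transversal to that tangent space (see `conormal_transversal` and `conormal_tangent`). -/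
def conormal {N : ℕ} (φ : V N → V (N + 1)) (u : V N) (ξ : V (N + 1)) : V (N + 1) →ₗ[ℝ] ℝ :=
  (frameDet φ u ξ)⁻¹ • frameDet φ u

theorem conormal_tangent {N : ℕ} (φ : V N → V (N + 1)) (u : V N) (ξ : V (N + 1)) (v : V N) :
    conormal φ u ξ (fderiv ℝ φ u v) = 0 := by
  have h : (frameDet φ u).comp (fderiv ℝ φ u : V N →ₗ[ℝ] V (N + 1)) = 0 := by
    refine LinearMap.pi_ext' fun i => LinearMap.ext_ring ?_
    simp only [LinearMap.comp_apply, LinearMap.single_apply, ContinuousLinearMap.coe_coe,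
      LinearMap.zero_apply, frameDet_apply, volSnoc, vol]
    refine Matrix.det_zero_of_row_eq (i := i.castSucc) (j := Fin.last N)
      (Fin.castSucc_lt_last i).ne ?_
    funext k
    simp [coordFrame]
  have h' := LinearMap.congr_fun h v
  simp only [LinearMap.comp_apply, ContinuousLinearMap.coe_coe, LinearMap.zero_apply] at h'
  simp [conormal, h']

theorem conormal_transversal {N : ℕ} (φ : V N → V (N + 1)) (u : V N) (ξ : V (N + 1))
    (himm : Function.Injective (fderiv ℝ φ u)) (hξ : ξ ∉ tangentSpace φ u) :
    conormal φ u ξ ξ = 1 := by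
  have hne : frameDet φ u ξ ≠ 0 := by
    have hli : LinearIndependent ℝ (coordFrame φ u) := by
      have hb := (Pi.basisFun ℝ (Fin N)).linearIndependent.map'
        (fderiv ℝ φ u : V N →ₗ[ℝ] V (N + 1)) (LinearMap.ker_eq_bot.2 himm)
      have he : coordFrame φ u = (fderiv ℝ φ u : V N →ₗ[ℝ] V (N + 1)) ∘ Pi.basisFun ℝ (Fin N) := by
        funext i
        simp [coordFrame]
      rw [he]
      exact hb
    have hspan : ξ ∉ Submodule.span ℝ (Set.range (coordFrame φ u)) := by
      intro hmem
      refine hξ (Submodule.span_le.2 ?_ hmem)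
      rintro _ ⟨i, rfl⟩
      exact ⟨Pi.single i 1, rfl⟩
    have hli' : LinearIndependent ℝ (Fin.snoc (α := fun _ => V (N + 1)) (coordFrame φ u) ξ) :=
      linearIndependent_finSnoc.2 ⟨hli, hspan⟩
    rw [frameDet_apply]
    have hu : IsUnit (Matrix.of (Fin.snoc (α := fun _ => V (N + 1)) (coordFrame φ u) ξ)) :=
      Matrix.linearIndependent_rows_iff_isUnit.1 hli'
    exact ((Matrix.isUnit_iff_isUnit_det _).1 hu).ne_zero
  simp [conormal, hne]

/-- The form `h` of the Gauss equation `D_X Y = ∇_X Y + h(X, Y) ξ` at `φ u`, in the coordinates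
of the parameterization: `h(v, w)` is the coefficient of `ξ` in `D_v D_w φ`. -/
def gaussForm {N : ℕ} (φ : V N → V (N + 1)) (u : V N) (ξ : V (N + 1)) (v w : V N) : ℝ :=
  conormal φ u ξ (secondDeriv φ u v w)

/-- The tangential component `∇_X Y` in the Gauss equation, for the coordinate fields `X`, `Y`
with constant coordinates `v`, `w`. -/
def nabla {N : ℕ} (φ : V N → V (N + 1)) (u : V N) (ξ : V (N + 1)) (v w : V N) : V (N + 1) :=
  secondDeriv φ u v w - gaussForm φ u ξ v w • ξ

/-- `S` is non-degenerate: the form `h` is non-degenerate (for every transversal vector). -/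
def IsNondegenerate {N : ℕ} (S : Set (V (N + 1))) : Prop :=
  ∀ φ U, IsParam S φ U → ∀ u ∈ U, ∀ ξ : V (N + 1), ξ ∉ tangentSpace φ u →
    ∀ v : V N, (∀ w : V N, gaussForm φ u ξ v w = 0) → v = 0

/-- `S` is convex: it lies on one side of each of its tangent hyperplanes. -/
def IsConvex {N : ℕ} (S : Set (V (N + 1))) : Prop :=
  ∀ φ U, IsParam S φ U → ∀ u ∈ U, ∃ l : V (N + 1) →ₗ[ℝ] ℝ, l ≠ 0 ∧
    (∀ v : V N, l (fderiv ℝ φ u v) = 0) ∧ ∀ q ∈ S, 0 ≤ l (q - φ u)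

/-- `S` is locally convex: near each of its points it lies on one side of the tangent
hyperplane at that point. -/
def IsLocallyConvex {N : ℕ} (S : Set (V (N + 1))) : Prop :=
  ∀ φ U, IsParam S φ U → ∀ u ∈ U, ∃ l : V (N + 1) →ₗ[ℝ] ℝ, l ≠ 0 ∧
    (∀ v : V N, l (fderiv ℝ φ u v) = 0) ∧ ∀ᶠ q in 𝓝[S] (φ u), 0 ≤ l (q - φ u)

/-- `ξ` is an affine normal vector field along `φ : U → ℝ^(N+1)`: it is smooth and transversal,
the induced volume form `θ = [·, …, ·, ξ]` is parallel for the induced connection, and it agrees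
(up to the orientation of the frame) with the volume form of the metric `h`. -/
structure IsAffineNormal {N : ℕ} (φ : V N → V (N + 1)) (U : Set (V N)) (ξ : V N → V (N + 1)) :
    Prop where
  smooth : ContDiffOn ℝ ∞ ξ U
  transversal : ∀ u ∈ U, ξ u ∉ tangentSpace φ u
  /- `v (θ(X₁, …, X_N)) = ∑ₖ θ(X₁, …, ∇_v Xₖ, …, X_N)` for fields of constant coordinates. -/
  parallel : ∀ u ∈ U, ∀ (v : V N) (w : Fin N → V N),
    fderiv ℝ (fun u' => volSnoc (fun i => fderiv ℝ φ u' (w i)) (ξ u')) u v =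
      ∑ k, volSnoc (Function.update (fun i => fderiv ℝ φ u (w i)) k
        (nabla φ u (ξ u) v (w k))) (ξ u)
  volume : ∀ u ∈ U, ∀ w : Fin N → V N,
    |volSnoc (fun i => fderiv ℝ φ u (w i)) (ξ u)| =
      Real.sqrt |(Matrix.of fun i j => gaussForm φ u (ξ u) (w i) (w j)).det|

/-- A parameterized open piece of the hypersurface `S`, with one of its (two, opposite)
affine normal vector fields. -/
structure Piece {N : ℕ} (S : Set (V (N + 1))) where
  φ : V N → V (N + 1)
  U : Set (V N)
  ξ : V N → V (N + 1)
  isParam : IsParam S φ U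
  isAffineNormal : IsAffineNormal φ U ξ

namespace Piece

variable {N : ℕ} {S : Set (V (N + 1))}

/-- The tangent vector at `φ u` with coordinates `v`. -/
def vec (P : Piece S) (u v : V N) : V (N + 1) := fderiv ℝ P.φ u v

/-- The conormal map. -/
def ν (P : Piece S) (u : V N) : V (N + 1) →ₗ[ℝ] ℝ := conormal P.φ u (P.ξ u)

/-- The Blaschke metric, on tangent vectors given by their coordinates. -/
def h (P : Piece S) (u v w : V N) : ℝ := gaussForm P.φ u (P.ξ u) v w

end Piece

section Pair

variable {N : ℕ} {S : Set (V (N + 1))}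

/-- The mid-point `M`. -/
def midPoint (p q : V (N + 1)) : V (N + 1) := (1 / 2 : ℝ) • (p + q)

/-- The mid-chord `C`. -/
def midChord (p q : V (N + 1)) : V (N + 1) := (1 / 2 : ℝ) • (p - q)

/-- `F(p₁, p₂, X) = (ν₂(C) ν₁ + ν₁(C) ν₂)(X - M)`, at `pᵢ = φᵢ(uᵢ)`. -/
def F (P₁ P₂ : Piece S) (u₁ u₂ : V N) (X : V (N + 1)) : ℝ :=
  (P₂.ν u₂ (midChord (P₁.φ u₁) (P₂.φ u₂)) • P₁.ν u₁ +
    P₁.ν u₁ (midChord (P₁.φ u₁) (P₂.φ u₂)) • P₂.ν u₂) (X - midPoint (P₁.φ u₁) (P₂.φ u₂))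

/-- `F_{p₁}(p₁, p₂, X)(W)`, for the tangent vector `W` with coordinates `w`. -/
def F₁ (P₁ P₂ : Piece S) (u₁ u₂ : V N) (X : V (N + 1)) (w : V N) : ℝ :=
  fderiv ℝ (fun u => F P₁ P₂ u u₂ X) u₁ w

/-- `F_{p₂}(p₁, p₂, X)(W)`, for the tangent vector `W` with coordinates `w`. -/
def F₂ (P₁ P₂ : Piece S) (u₁ u₂ : V N) (X : V (N + 1)) (w : V N) : ℝ :=
  fderiv ℝ (fun u => F P₁ P₂ u₁ u X) u₂ w

/-- The system for `X`, in terms of the coordinates `yᵢ` of `Yᵢ`, and of the coordinates `z₁ j`,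
`z₂ j` of the vector `Z_j` in the two tangent spaces. -/
structure IsSolution (P₁ P₂ : Piece S) (u₁ u₂ y₁ y₂ : V N) (z₁ z₂ : Fin (N - 1) → V N)
    (X : V (N + 1)) : Prop where
  eq_zero : F P₁ P₂ u₁ u₂ X = 0
  eq_Y₁ : F₁ P₁ P₂ u₁ u₂ X y₁ = 0
  eq_Y₂ : F₂ P₁ P₂ u₁ u₂ X y₂ = 0
  eq_Z₁ : ∀ j, F₁ P₁ P₂ u₁ u₂ X (z₁ j) = 0
  eq_Z₂ : ∀ j, F₂ P₁ P₂ u₁ u₂ X (z₂ j) = 0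

/-- The real cube root. -/
def cbrt (x : ℝ) : ℝ := Real.sign x * |x| ^ (1 / 3 : ℝ)

theorem cbrt_pow_three (x : ℝ) : cbrt x ^ 3 = x := by
  have h : (|x| ^ (1 / 3 : ℝ)) ^ 3 = |x| := by
    rw [← Real.rpow_natCast, ← Real.rpow_mul (abs_nonneg x)]
    norm_num
  rw [cbrt, mul_pow, h]
  rcases lt_trichotomy x 0 with hx | hx | hx
  · rw [Real.sign_of_neg hx, abs_of_neg hx]; ring
  · simp [hx]
  · rw [Real.sign_of_pos hx, abs_of_pos hx]; ring

/-- `λ = (ν₁(Y₂)² h₁(Y₁, Y₁) / (ν₂(Y₁)² h₂(Y₂, Y₂)))^(1/3)`. -/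
def lam (P₁ P₂ : Piece S) (u₁ u₂ y₁ y₂ : V N) : ℝ :=
  cbrt ((P₁.ν u₁ (P₂.vec u₂ y₂)) ^ 2 / (P₂.ν u₂ (P₁.vec u₁ y₁)) ^ 2 *
    (P₁.h u₁ y₁ y₁ / P₂.h u₂ y₂ y₂))

/-- `b = - h₁(Y₁, Y₁) / ν₂(Y₁)`, the coefficient of `ν₂` in `D_{Y₁} ν₁ = a ν₁ + b ν₂`. -/
def coeffB (P₁ P₂ : Piece S) (u₁ u₂ y₁ : V N) : ℝ :=
  -(P₁.h u₁ y₁ y₁) / P₂.ν u₂ (P₁.vec u₁ y₁)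

/-- `λ ν₂(Y₁) / ν₁(Y₂)`. -/
def kap (P₁ P₂ : Piece S) (u₁ u₂ y₁ y₂ : V N) : ℝ :=
  lam P₁ P₂ u₁ u₂ y₁ y₂ * P₂.ν u₂ (P₁.vec u₁ y₁) / P₁.ν u₁ (P₂.vec u₂ y₂)

end Pair

end EMH

end

open EMH

open scoped ContDiff Topology

noncomputable section

/-! Local convexity makes each `hᵢ` semi-definite, and non-degeneracy then makes it definite. So
`Yᵢ`, being `hᵢ`-orthogonal to `T₁ ∩ T₂`, lies outside the other tangent space, and the whole space
is `span {Y₁, Y₂} ⊕ (T₁ ∩ T₂)`. Write `C = c₁Y₁ + c₂Y₂ + w` and `X - M = x₁Y₁ + x₂Y₂ + w'`.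

Differentiating `νᵢ = 0` on tangent vectors gives `(D_W νᵢ)(V) = -hᵢ(W, V)` (`Piece.dν_vec`). Hence
`D_{Yᵢ} νᵢ` kills `T₁ ∩ T₂`, each `D_{Z_j} νᵢ` kills `Yᵢ`, and the system separates
(`linSystem_iff_coords`). There remain three scalar equations in `c₁, c₂, x₁, x₂`, and the vector
equations `c₁w' + x₁w = 0`, `c₂w' + x₂w = 0`.

Convexity, or the assumption on `M`, excludes `C ∈ T₁ ∩ T₂`, that is `c₁ = c₂ = 0`. The scalar
equations then force `c₁x₂ = -c₂x₁ ≠ 0`, so the vector equations have non-zero determinant and `w =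
0`: this is coplanarity. Eliminating `x₁, x₂` leaves a relation between `c₁³` and `c₂³`, whose real
cube root is `ν₁(C) = -λν₂(C)`. Conversely, under these conditions `w' = 0`, and the scalar
equations reduce to the one linear equation `x₁(λ + 4Ab) = -λA`. -/

namespace EMH

/-! ### Linear algebra of the system -/

section LinearAlgebra

variable {E : Type*} [AddCommGroup E] [Module ℝ E]

/-- Decomposition along two vectors and the intersection of the kernels of two functionals. -/
theorem exists_eq_add_mem_ker_inf_ker (ν₁ ν₂ : E →ₗ[ℝ] ℝ) {Y₁ Y₂ : E} (h₁ : ν₁ Y₁ = 0)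
    (h₂ : ν₂ Y₂ = 0) (hm : ν₂ Y₁ ≠ 0) (hn : ν₁ Y₂ ≠ 0) (x : E) :
    ∃ (a c : ℝ) (w : E), ν₁ w = 0 ∧ ν₂ w = 0 ∧ x = a • Y₁ + c • Y₂ + w := by
  refine ⟨ν₂ x / ν₂ Y₁, ν₁ x / ν₁ Y₂,
    x - (ν₂ x / ν₂ Y₁) • Y₁ - (ν₁ x / ν₁ Y₂) • Y₂, ?_, ?_, by abel⟩
  · simp [h₁, hn]
  · simp [h₂, hm]

/-- The scalar part of the system, solved for the ratio `κ` of the coordinates. -/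
theorem scalar_system_necessary {c₁ c₂ x₁ x₂ m n H₁ H₂ : ℝ} (hm : m ≠ 0) (hn : n ≠ 0)
    (hH₁ : H₁ ≠ 0) (hH₂ : H₂ ≠ 0) (hc : ¬ (c₁ = 0 ∧ c₂ = 0))
    (e₀ : c₁ * x₂ + c₂ * x₁ = 0) (e₁ : n * (x₂ - c₂) = 4 * H₁ * c₁ * x₁)
    (e₂ : m * (x₁ + c₁) = -(4 * H₂ * c₂ * x₂)) :
    c₁ ≠ 0 ∧ c₂ ≠ 0 ∧ c₁ * x₂ ≠ 0 ∧ n * c₂ ^ 3 * H₂ = -(m * H₁ * c₁ ^ 3) := by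
  have hc₁ : c₁ ≠ 0 := by
    rintro rfl
    have hc₂ : c₂ ≠ 0 := fun h => hc ⟨rfl, h⟩
    have hx₁ : x₁ = 0 := by simpa [hc₂] using e₀
    have hx₂ : x₂ = c₂ := by simpa [hx₁, hn, sub_eq_zero] using e₁
    simp [hx₁, hx₂, hc₂, hH₂] at e₂
  have hc₂ : c₂ ≠ 0 := by
    rintro rfl
    have hx₂ : x₂ = 0 := by simpa [hc₁] using e₀
    have hx₁ : x₁ = -c₁ := by
      have : x₁ + c₁ = 0 := by simpa [hx₂, hm] using e₂
      linarith
    simp [hx₁, hx₂, hc₁, hH₁] at e₁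
  have hx₂ : x₂ ≠ 0 := by
    rintro rfl
    have hx₁ : x₁ = 0 := by simpa [hc₂] using e₀
    simp [hx₁, hn, hc₂] at e₁
  have hx₁ : x₁ ≠ 0 := by
    rintro rfl
    simp [hc₁, hx₂] at e₀
  refine ⟨hc₁, hc₂, mul_ne_zero hc₁ hx₂, ?_⟩
  -- `e₀` eliminates `x₂` from `e₁` and `e₂`; cross-multiplying the two results then cancels the
  -- common factor `x₁ (x₁ + c₁)`.
  have k₁ : n * c₂ * (x₁ + c₁) = -(4 * H₁ * c₁ ^ 2 * x₁) := by
    linear_combination (-c₁) * e₁ + n * e₀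
  have k₂ : m * c₁ * (x₁ + c₁) = 4 * H₂ * c₂ ^ 2 * x₁ := by
    linear_combination c₁ * e₂ - 4 * H₂ * c₂ * e₀
  have hs : x₁ + c₁ ≠ 0 := by
    intro h
    rw [h] at k₂
    simp [hH₂, hc₂, hx₁] at k₂
  have : (x₁ * (x₁ + c₁)) * (n * c₂ ^ 3 * H₂ + m * H₁ * c₁ ^ 3) = 0 := by
    linear_combination H₂ * c₂ ^ 2 * x₁ * k₁ + H₁ * c₁ ^ 2 * x₁ * k₂
  have := (mul_eq_zero.1 this).resolve_left (mul_ne_zero hx₁ hs)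
  linarith

/-- The scalar part of the system when the coordinates of `C` are `(A, -κA)`, `κ = lm/n`. -/
theorem scalar_system_iff {A x₁ x₂ m n H₁ H₂ l : ℝ} (hm : m ≠ 0) (hn : n ≠ 0)
    (hH₁ : H₁ ≠ 0) (hH₂ : H₂ ≠ 0) (hl : l ^ 3 = n ^ 2 / m ^ 2 * (H₁ / H₂)) (hA : A ≠ 0) :
    (A * x₂ + -(l * m / n * A) * x₁ = 0 ∧ n * (x₂ - -(l * m / n * A)) = 4 * H₁ * A * x₁ ∧
      m * (x₁ + A) = -(4 * H₂ * -(l * m / n * A) * x₂)) ↔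
    l + 4 * A * (-H₁ / m) ≠ 0 ∧ x₁ = -(l * A) / (l + 4 * A * (-H₁ / m)) ∧
      x₂ = -(l * A) / (l + 4 * A * (-H₁ / m)) * (l * m / n) := by
  have hl' : l ^ 3 * m ^ 2 * H₂ = n ^ 2 * H₁ := by
    rw [hl]; field_simp
  have hl0 : l ≠ 0 := by
    rintro rfl
    have : n ^ 2 * H₁ = 0 := by rw [← hl']; ring
    simp [hn, hH₁] at this
  constructor
  -- The third equation is redundant: by the choice of `l ^ 3` it follows from the other two.
  · rintro ⟨e₀, e₁, -⟩
    have hx₂ : x₂ = x₁ * (l * m / n) := by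
      refine mul_left_cancel₀ hA ?_
      linear_combination e₀
    have key : x₁ * (l + 4 * A * (-H₁ / m)) = -(l * A) := by
      rw [hx₂] at e₁
      field_simp at e₁ ⊢
      linear_combination e₁
    have hne : l + 4 * A * (-H₁ / m) ≠ 0 := by
      intro h
      rw [h] at key
      simp [hl0, hA] at key
    have hx₁ := (eq_div_iff hne).2 key
    exact ⟨hne, hx₁, by rw [← hx₁]; exact hx₂⟩
  · rintro ⟨hne, hx₁, hx₂⟩
    rw [← hx₁] at hx₂
    have key : x₁ * (l + 4 * A * (-H₁ / m)) = -(l * A) := (eq_div_iff hne).1 hx₁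
    have key' : x₁ * (l * m - 4 * A * H₁) = -(l * A * m) := by
      field_simp at key
      linear_combination key
    subst hx₂
    refine ⟨by ring, ?_, ?_⟩
    · field_simp
      linear_combination key'
    · field_simp
      have : l * (n ^ 2 * (x₁ + A)) * m = l * (4 * H₂ * l ^ 2 * m * A * x₁) * m := by
        -- `hl'` replaces `n ^ 2 * H₁`, which turns the linear equation for `x₁` into the
        -- `Y₂`-equation multiplied by `l * m`.
        linear_combination n ^ 2 * key' + (-4 * A * x₁) * hl'
      have := mul_left_cancel₀ hl0 (by linear_combination this :
        l * (n ^ 2 * (x₁ + A) * m) = l * (4 * H₂ * l ^ 2 * m * A * x₁ * m))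
      have := mul_right_cancel₀ hm this
      linear_combination this

/-- The system in terms of the functionals `νᵢ` and their derivatives: `d₁`, `d₂` in the
directions `Y₁`, `Y₂`, and `e₁ j`, `e₂ j` in the directions `Z_j`. -/
structure LinSystem {ι : Type*} (ν₁ ν₂ d₁ d₂ : E →ₗ[ℝ] ℝ) (e₁ e₂ : ι → E →ₗ[ℝ] ℝ)
    (Y₁ Y₂ C x : E) : Prop where
  eq_zero : ν₂ C * ν₁ x + ν₁ C * ν₂ x = 0
  eq_Y₁ : 1 / 2 * ν₂ Y₁ * (ν₁ x - ν₁ C) + ν₂ C * d₁ x + d₁ C * ν₂ x = 0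
  eq_Y₂ : -(1 / 2) * ν₁ Y₂ * (ν₂ x + ν₂ C) + ν₁ C * d₂ x + d₂ C * ν₁ x = 0
  eq_Z₁ : ∀ j, ν₂ C * e₁ j x + e₁ j C * ν₂ x = 0
  eq_Z₂ : ∀ j, ν₁ C * e₂ j x + e₂ j C * ν₁ x = 0

variable {ι : Type*} {ν₁ ν₂ d₁ d₂ : E →ₗ[ℝ] ℝ} {e₁ e₂ : ι → E →ₗ[ℝ] ℝ} {Y₁ Y₂ : E}

/-- The mixed terms `d₁ Y₂`, `d₂ Y₁`, `e₁ j Y₂`, `e₂ j Y₁` occur only as multiples of `c₁x₂ + c₂x₁`,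
which vanishes by the first equation. What is left of the `Z_j`-equations says that all `e₁ j`,
respectively all `e₂ j`, vanish on a vector of the common kernel, so `hw₁` and `hw₂` make that
vector zero. -/
theorem linSystem_iff_coords (h₁ : ν₁ Y₁ = 0) (h₂ : ν₂ Y₂ = 0) (hm : ν₂ Y₁ ≠ 0)
    (hn : ν₁ Y₂ ≠ 0) (hd₁ : ∀ w, ν₁ w = 0 → ν₂ w = 0 → d₁ w = 0)
    (hd₂ : ∀ w, ν₁ w = 0 → ν₂ w = 0 → d₂ w = 0)
    (he₁ : ∀ j, e₁ j Y₁ = 0) (he₂ : ∀ j, e₂ j Y₂ = 0)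
    (hw₁ : ∀ w, ν₁ w = 0 → ν₂ w = 0 → (∀ j, e₁ j w = 0) → w = 0)
    (hw₂ : ∀ w, ν₁ w = 0 → ν₂ w = 0 → (∀ j, e₂ j w = 0) → w = 0)
    {c₁ c₂ x₁ x₂ : ℝ} {w w' : E} (hwν₁ : ν₁ w = 0) (hwν₂ : ν₂ w = 0) (hw'ν₁ : ν₁ w' = 0)
    (hw'ν₂ : ν₂ w' = 0) :
    LinSystem ν₁ ν₂ d₁ d₂ e₁ e₂ Y₁ Y₂ (c₁ • Y₁ + c₂ • Y₂ + w) (x₁ • Y₁ + x₂ • Y₂ + w') ↔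
      (c₁ * x₂ + c₂ * x₁ = 0 ∧ ν₁ Y₂ * (x₂ - c₂) = 4 * (-d₁ Y₁) * c₁ * x₁ ∧
        ν₂ Y₁ * (x₁ + c₁) = -(4 * (-d₂ Y₂) * c₂ * x₂)) ∧
      c₁ • w' + x₁ • w = 0 ∧ c₂ • w' + x₂ • w = 0 := by
  have hdw := hd₁ w hwν₁ hwν₂
  have hdw' := hd₁ w' hw'ν₁ hw'ν₂
  have hdw₂ := hd₂ w hwν₁ hwν₂
  have hdw₂' := hd₂ w' hw'ν₁ hw'ν₂
  constructor
  · rintro ⟨f₀, f₁, f₂, g₁, g₂⟩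
    simp only [map_add, map_smul, smul_eq_mul, h₁, h₂, hwν₁, hwν₂, hw'ν₁, hw'ν₂, hdw, hdw',
      hdw₂, hdw₂', he₁, he₂, mul_zero, add_zero, zero_add] at f₀ f₁ f₂ g₁ g₂
    have k₀ : c₁ * x₂ + c₂ * x₁ = 0 := by
      refine mul_left_cancel₀ (mul_ne_zero hm hn) ?_
      linear_combination f₀
    refine ⟨⟨k₀, ?_, ?_⟩, hw₁ _ ?_ ?_ fun j => ?_, hw₂ _ ?_ ?_ fun j => ?_⟩
    · refine mul_left_cancel₀ hm ?_
      linear_combination 2 * f₁ - 2 * ν₂ Y₁ * d₁ Y₂ * k₀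
    · refine mul_left_cancel₀ hn ?_
      linear_combination -2 * f₂ + 2 * ν₁ Y₂ * d₂ Y₁ * k₀
    · simp [hwν₁, hw'ν₁]
    · simp [hwν₂, hw'ν₂]
    · simp only [map_add, map_smul, smul_eq_mul]
      refine mul_left_cancel₀ hm ?_
      linear_combination g₁ j - ν₂ Y₁ * e₁ j Y₂ * k₀
    · simp [hwν₁, hw'ν₁]
    · simp [hwν₂, hw'ν₂]
    · simp only [map_add, map_smul, smul_eq_mul]
      refine mul_left_cancel₀ hn ?_
      linear_combination g₂ j - ν₁ Y₂ * e₂ j Y₁ * k₀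
  · rintro ⟨⟨k₀, k₁, k₂⟩, l₁, l₂⟩
    constructor <;> simp only [map_add, map_smul, smul_eq_mul, h₁, h₂, hwν₁, hwν₂, hw'ν₁, hw'ν₂,
      hdw, hdw', hdw₂, hdw₂', he₁, he₂, mul_zero, add_zero, zero_add]
    · linear_combination ν₂ Y₁ * ν₁ Y₂ * k₀
    · linear_combination (1 / 2) * ν₂ Y₁ * k₁ + ν₂ Y₁ * d₁ Y₂ * k₀
    · linear_combination -(1 / 2) * ν₁ Y₂ * k₂ + ν₁ Y₂ * d₂ Y₁ * k₀
    · intro j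
      have := congrArg (e₁ j) l₁
      simp only [map_add, map_smul, smul_eq_mul, map_zero] at this
      linear_combination ν₂ Y₁ * this + ν₂ Y₁ * e₁ j Y₂ * k₀
    · intro j
      have := congrArg (e₂ j) l₂
      simp only [map_add, map_smul, smul_eq_mul, map_zero] at this
      linear_combination ν₁ Y₂ * this + ν₁ Y₂ * e₂ j Y₁ * k₀

/-- Here `C` has coordinates `(A, -κA)` and no component in the common kernel, so the first vector
equation reads `A w' = 0` with `A ≠ 0`; `scalar_system_iff` settles the rest. -/
theorem linSystem_solution (h₁ : ν₁ Y₁ = 0) (h₂ : ν₂ Y₂ = 0) (hm : ν₂ Y₁ ≠ 0)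
    (hn : ν₁ Y₂ ≠ 0) (hd₁ : ∀ w, ν₁ w = 0 → ν₂ w = 0 → d₁ w = 0)
    (hd₂ : ∀ w, ν₁ w = 0 → ν₂ w = 0 → d₂ w = 0)
    (he₁ : ∀ j, e₁ j Y₁ = 0) (he₂ : ∀ j, e₂ j Y₂ = 0)
    (hw₁ : ∀ w, ν₁ w = 0 → ν₂ w = 0 → (∀ j, e₁ j w = 0) → w = 0)
    (hw₂ : ∀ w, ν₁ w = 0 → ν₂ w = 0 → (∀ j, e₂ j w = 0) → w = 0)
    {H₁ H₂ l : ℝ} (hdY₁ : d₁ Y₁ = -H₁) (hdY₂ : d₂ Y₂ = -H₂) (hH₁ : H₁ ≠ 0) (hH₂ : H₂ ≠ 0)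
    (hl : l ^ 3 = (ν₁ Y₂) ^ 2 / (ν₂ Y₁) ^ 2 * (H₁ / H₂)) {C : E}
    (hC : ¬ (ν₁ C = 0 ∧ ν₂ C = 0)) {A : ℝ} (hA : C = A • (Y₁ - (l * ν₂ Y₁ / ν₁ Y₂) • Y₂))
    (x : E) :
    LinSystem ν₁ ν₂ d₁ d₂ e₁ e₂ Y₁ Y₂ C x ↔ l + 4 * A * (-H₁ / ν₂ Y₁) ≠ 0 ∧
      x = (-(l * A) / (l + 4 * A * (-H₁ / ν₂ Y₁))) • (Y₁ + (l * ν₂ Y₁ / ν₁ Y₂) • Y₂) := by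
  have hA0 : A ≠ 0 := by
    rintro rfl
    exact hC (by simp [hA])
  have hl0 : l ≠ 0 := by
    rintro rfl
    have : (ν₁ Y₂) ^ 2 / (ν₂ Y₁) ^ 2 * (H₁ / H₂) ≠ 0 := by positivity
    exact this (by rw [← hl]; ring)
  obtain ⟨x₁, x₂, w, hwν₁, hwν₂, rfl⟩ := exists_eq_add_mem_ker_inf_ker ν₁ ν₂ h₁ h₂ hm hn x
  have hC' : C = A • Y₁ + (-(l * ν₂ Y₁ / ν₁ Y₂ * A)) • Y₂ + 0 := by
    rw [hA]; module
  have H := linSystem_iff_coords h₁ h₂ hm hn hd₁ hd₂ he₁ he₂ hw₁ hw₂ (c₁ := A)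
    (c₂ := -(l * ν₂ Y₁ / ν₁ Y₂ * A)) (x₁ := x₁) (x₂ := x₂) (map_zero ν₁) (map_zero ν₂) hwν₁ hwν₂
  rw [hC', H, hdY₁, hdY₂, neg_neg, neg_neg, scalar_system_iff hm hn hH₁ hH₂ hl hA0]
  constructor
  · rintro ⟨⟨hne, hx₁, hx₂⟩, hw, -⟩
    have hw0 : w = 0 := by simpa [hA0] using hw
    refine ⟨hne, ?_⟩
    rw [hw0, hx₂, ← hx₁]
    module
  · rintro ⟨hne, hx⟩
    set B := -(l * A) / (l + 4 * A * (-H₁ / ν₂ Y₁)) with hB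
    have k₁ := congrArg ν₁ hx
    have k₂ := congrArg ν₂ hx
    simp only [map_add, map_smul, smul_eq_mul, h₁, h₂, hwν₁, hwν₂, mul_zero, add_zero,
      zero_add] at k₁ k₂
    have hx₁ : x₁ = B := mul_right_cancel₀ hm k₂
    have hx₂ : x₂ = B * (l * ν₂ Y₁ / ν₁ Y₂) := by
      refine mul_right_cancel₀ hn ?_
      linear_combination k₁
    have hw0 : w = 0 := by
      rw [hx₁, hx₂] at hx
      have : w = B • (Y₁ + (l * ν₂ Y₁ / ν₁ Y₂) • Y₂) -
        (B • Y₁ + (B * (l * ν₂ Y₁ / ν₁ Y₂)) • Y₂) := eq_sub_of_add_eq' hx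
      rw [this]; module
    refine ⟨⟨hne, hx₁, hx₂⟩, ?_, ?_⟩ <;> simp [hw0]

theorem linSystem_necessary (h₁ : ν₁ Y₁ = 0) (h₂ : ν₂ Y₂ = 0) (hm : ν₂ Y₁ ≠ 0)
    (hn : ν₁ Y₂ ≠ 0) (hd₁ : ∀ w, ν₁ w = 0 → ν₂ w = 0 → d₁ w = 0)
    (hd₂ : ∀ w, ν₁ w = 0 → ν₂ w = 0 → d₂ w = 0)
    (he₁ : ∀ j, e₁ j Y₁ = 0) (he₂ : ∀ j, e₂ j Y₂ = 0)
    (hw₁ : ∀ w, ν₁ w = 0 → ν₂ w = 0 → (∀ j, e₁ j w = 0) → w = 0)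
    (hw₂ : ∀ w, ν₁ w = 0 → ν₂ w = 0 → (∀ j, e₂ j w = 0) → w = 0)
    {H₁ H₂ l : ℝ} (hdY₁ : d₁ Y₁ = -H₁) (hdY₂ : d₂ Y₂ = -H₂) (hH₁ : H₁ ≠ 0) (hH₂ : H₂ ≠ 0)
    (hl : l ^ 3 = (ν₁ Y₂) ^ 2 / (ν₂ Y₁) ^ 2 * (H₁ / H₂)) {C : E}
    (hC : ¬ (ν₁ C = 0 ∧ ν₂ C = 0)) {x : E} (hx : LinSystem ν₁ ν₂ d₁ d₂ e₁ e₂ Y₁ Y₂ C x) :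
    C ∈ Submodule.span ℝ {Y₁, Y₂} ∧ ν₁ C = -l * ν₂ C := by
  obtain ⟨x₁, x₂, w', hw'ν₁, hw'ν₂, rfl⟩ := exists_eq_add_mem_ker_inf_ker ν₁ ν₂ h₁ h₂ hm hn x
  obtain ⟨c₁, c₂, w, hwν₁, hwν₂, rfl⟩ := exists_eq_add_mem_ker_inf_ker ν₁ ν₂ h₁ h₂ hm hn C
  rw [linSystem_iff_coords h₁ h₂ hm hn hd₁ hd₂ he₁ he₂ hw₁ hw₂ hwν₁ hwν₂ hw'ν₁ hw'ν₂,
    hdY₁, hdY₂, neg_neg, neg_neg] at hx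
  obtain ⟨⟨k₀, k₁, k₂⟩, l₁, l₂⟩ := hx
  have hc : ¬ (c₁ = 0 ∧ c₂ = 0) := by
    rintro ⟨rfl, rfl⟩
    exact hC (by simp [hwν₁, hwν₂])
  obtain ⟨hc₁, hc₂, hcx, hcube⟩ := scalar_system_necessary hm hn hH₁ hH₂ hc k₀ k₁ k₂
  have hw0 : w = 0 := by
    -- Eliminating `w'` leaves the determinant `c₁x₂ - c₂x₁`, which equals `2c₁x₂` by `k₀`.
    have : (2 * (c₁ * x₂)) • w = 0 := by
      have e : (2 * (c₁ * x₂)) • w = c₁ • (c₂ • w' + x₂ • w) - c₂ • (c₁ • w' + x₁ • w) +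
          (c₁ * x₂ + c₂ * x₁) • w := by module
      rw [e, l₁, l₂, k₀]; simp
    exact (smul_eq_zero.1 this).resolve_left (by simpa using hcx)
  refine ⟨Submodule.mem_span_pair.2 ⟨c₁, c₂, by rw [hw0, add_zero]⟩, ?_⟩
  simp only [map_add, map_smul, smul_eq_mul, h₁, h₂, hwν₁, hwν₂, mul_zero, add_zero, zero_add]
  -- Cubing is injective on the reals, so it suffices to compare cubes.
  refine (Odd.strictMono_pow (⟨1, rfl⟩ : Odd 3)).injective ?_
  have hl' : l ^ 3 * (ν₂ Y₁) ^ 2 * H₂ = (ν₁ Y₂) ^ 2 * H₁ := by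
    rw [hl]; field_simp
  refine mul_right_cancel₀ hH₂ ?_
  linear_combination (ν₁ Y₂) ^ 2 * hcube + ν₂ Y₁ * c₁ ^ 3 * hl'

/-- The two conditions on `C` determine its coordinate `A`. -/
theorem existsUnique_coord (h₁ : ν₁ Y₁ = 0) (h₂ : ν₂ Y₂ = 0) (hm : ν₂ Y₁ ≠ 0) (hn : ν₁ Y₂ ≠ 0)
    {l : ℝ} {C : E} (hC : C ∈ Submodule.span ℝ {Y₁, Y₂}) (hl : ν₁ C = -l * ν₂ C) :
    ∃! A : ℝ, C = A • (Y₁ - (l * ν₂ Y₁ / ν₁ Y₂) • Y₂) := by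
  obtain ⟨a, c, rfl⟩ := Submodule.mem_span_pair.1 hC
  simp only [map_add, map_smul, smul_eq_mul, h₁, h₂, mul_zero, add_zero, zero_add] at hl
  have hc : c = -(a * (l * ν₂ Y₁ / ν₁ Y₂)) := by
    field_simp
    linear_combination hl
  refine ⟨a, ?_, fun A hA => ?_⟩
  · simp only [hc]; module
  · have := congrArg ν₂ hA
    simp only [map_add, map_sub, map_smul, smul_eq_mul, h₂, mul_zero, add_zero, sub_zero] at this
    exact (mul_right_cancel₀ hm this).symm

end LinearAlgebra

/-! ### Smoothness of the conormal map and its derivative -/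

section Conormal

variable {N : ℕ} {S : Set (V (N + 1))}

/-- The volume form as a continuous multilinear map. -/
def volCLM (N : ℕ) : ContinuousMultilinearMap ℝ (fun _ : Fin (N + 1) => V (N + 1)) ℝ where
  toMultilinearMap := (Matrix.detRowAlternating (R := ℝ) (n := Fin (N + 1))).toMultilinearMap
  cont := Continuous.matrix_det continuous_id

theorem contDiffOn_frameDet {φ : V N → V (N + 1)} {U : Set (V N)} (hU : IsOpen U)
    (hφ : ContDiffOn ℝ ∞ φ U) {f : V N → V (N + 1)} (hf : ContDiffOn ℝ ∞ f U) :
    ContDiffOn ℝ ∞ (fun u => frameDet φ u (f u)) U := by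
  have h : (fun u => frameDet φ u (f u)) = fun u =>
      volCLM N (Fin.snoc (α := fun _ => V (N + 1)) (coordFrame φ u) (f u)) := by
    funext u
    rw [frameDet_apply]
    rfl
  rw [h]
  refine (volCLM N).contDiff.comp_contDiffOn (contDiffOn_pi.2 fun i => ?_)
  refine Fin.lastCases ?_ (fun k => ?_) i
  · simpa using hf
  · simp only [Fin.snoc_castSucc, coordFrame]
    exact (hφ.fderiv_of_isOpen hU (by simp)).clm_apply contDiffOn_const

theorem frameDet_ne_zero {φ : V N → V (N + 1)} {u : V N} {ξ : V (N + 1)}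
    (himm : Function.Injective (fderiv ℝ φ u)) (hξ : ξ ∉ tangentSpace φ u) :
    frameDet φ u ξ ≠ 0 := by
  intro h
  simpa [conormal, h] using conormal_transversal φ u ξ himm hξ

namespace Piece

theorem ν_vec (P : Piece S) (u v : V N) : P.ν u (P.vec u v) = 0 :=
  conormal_tangent _ _ _ _

theorem ν_ξ (P : Piece S) {u : V N} (hu : u ∈ P.U) : P.ν u (P.ξ u) = 1 :=
  conormal_transversal _ _ _ (P.isParam.immersion u hu) (P.isAffineNormal.transversal u hu)

theorem contDiffAt_φ (P : Piece S) {u : V N} (hu : u ∈ P.U) : ContDiffAt ℝ ∞ P.φ u :=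
  P.isParam.smooth.contDiffAt (P.isParam.isOpen.mem_nhds hu)

theorem differentiableAt_φ (P : Piece S) {u : V N} (hu : u ∈ P.U) : DifferentiableAt ℝ P.φ u :=
  (P.contDiffAt_φ hu).differentiableAt (by simp)

theorem differentiableAt_fderiv_φ (P : Piece S) {u : V N} (hu : u ∈ P.U) :
    DifferentiableAt ℝ (fderiv ℝ P.φ) u :=
  ((P.contDiffAt_φ hu).fderiv_right (m := 1) (by norm_cast)).differentiableAt (by simp)

/-- The conormal as a continuous functional. -/
def νL (P : Piece S) (u : V N) : V (N + 1) →L[ℝ] ℝ := LinearMap.toContinuousLinearMap (P.ν u)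

theorem νL_apply (P : Piece S) (u : V N) (x : V (N + 1)) : P.νL u x = P.ν u x := rfl

theorem differentiableAt_νL (P : Piece S) {u : V N} (hu : u ∈ P.U) :
    DifferentiableAt ℝ P.νL u := by
  have h : ContDiffOn ℝ ∞ P.νL P.U := by
    refine contDiffOn_clm_apply.2 fun x => ?_
    have e : (fun u => P.νL u x) = fun u => (frameDet P.φ u (P.ξ u))⁻¹ * frameDet P.φ u x := rfl
    rw [e]
    refine ContDiffOn.mul (ContDiffOn.inv ?_ fun u hu => frameDet_ne_zero
      (P.isParam.immersion u hu) (P.isAffineNormal.transversal u hu)) ?_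
    · exact contDiffOn_frameDet P.isParam.isOpen P.isParam.smooth P.isAffineNormal.smooth
    · exact contDiffOn_frameDet P.isParam.isOpen P.isParam.smooth contDiffOn_const
  exact (h.contDiffAt (P.isParam.isOpen.mem_nhds hu)).differentiableAt (by simp)

/-- The derivative of the conormal map. -/
def dν (P : Piece S) (u w : V N) : V (N + 1) →ₗ[ℝ] ℝ := (fderiv ℝ P.νL u w : V (N + 1) →L[ℝ] ℝ)

/-- This is the derivative in direction `w` of the identity `ν(D_v φ) = 0`. -/
theorem dν_vec (P : Piece S) {u : V N} (hu : u ∈ P.U) (w v : V N) :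
    P.dν u w (P.vec u v) = -P.h u w v := by
  have hd := (P.differentiableAt_νL hu).hasFDerivAt.clm_apply
    ((P.differentiableAt_fderiv_φ hu).hasFDerivAt.clm_apply (hasFDerivAt_const v u))
  -- The identity holds at every parameter, even outside `P.U`, so the function is literally
  -- constant.
  have hz : (fun u => P.νL u (fderiv ℝ P.φ u v)) = fun _ => 0 := by
    funext u
    exact P.ν_vec u v
  rw [hz] at hd
  have := congrArg (fun L => L w) (hd.unique (hasFDerivAt_const (0 : ℝ) u))
  simp at this
  have e : P.h u w v = P.νL u (fderiv ℝ (fderiv ℝ P.φ) u w v) := rfl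
  rw [e]
  simp only [dν, vec, ContinuousLinearMap.coe_coe]
  linarith

theorem h_symm (P : Piece S) {u : V N} (hu : u ∈ P.U) (v w : V N) : P.h u v w = P.h u w v := by
  have : IsSymmSndFDerivAt ℝ P.φ u := (P.contDiffAt_φ hu).isSymmSndFDerivAt (by
    rw [minSmoothness_of_isRCLikeNormedField]
    exact WithTop.coe_le_coe.2 (le_top : (2 : ℕ∞) ≤ ⊤))
  simp only [h, gaussForm, secondDeriv, this.eq v w]

/-- The Blaschke metric as a bilinear form. -/
def hForm (P : Piece S) (u : V N) : V N →ₗ[ℝ] V N →ₗ[ℝ] ℝ :=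
  LinearMap.mk₂ ℝ (P.h u) (fun v v' w => by simp [h, gaussForm, secondDeriv])
    (fun c v w => by simp [h, gaussForm, secondDeriv])
    (fun v w w' => by simp [h, gaussForm, secondDeriv])
    (fun c v w => by simp [h, gaussForm, secondDeriv])

theorem hForm_apply (P : Piece S) (u v w : V N) : P.hForm u v w = P.h u v w := rfl

/-- The tangent space is contained in the kernel of `ν`, and both have dimension `N`. -/
theorem mem_tangentSpace_iff (P : Piece S) {u : V N} (hu : u ∈ P.U) (x : V (N + 1)) :
    x ∈ tangentSpace P.φ u ↔ P.ν u x = 0 := by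
  have hle : tangentSpace P.φ u ≤ LinearMap.ker (P.ν u) := by
    rintro _ ⟨v, rfl⟩
    exact P.ν_vec u v
  have hne : P.ν u ≠ 0 := by
    intro h
    simpa [h] using P.ν_ξ hu
  have hr : Module.finrank ℝ (tangentSpace P.φ u) = N := by
    rw [tangentSpace, LinearMap.finrank_range_of_inj (P.isParam.immersion u hu)]
    simp
  have hk : Module.finrank ℝ (LinearMap.ker (P.ν u)) = N := by
    have := Module.Dual.finrank_ker_add_one_of_ne_zero hne
    simpa using this
  rw [Submodule.eq_of_le_of_finrank_eq hle (by rw [hr, hk]), LinearMap.mem_ker]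

theorem vec_injective (P : Piece S) {u : V N} (hu : u ∈ P.U) : Function.Injective (P.vec u) :=
  P.isParam.immersion u hu

theorem φ_mem (P : Piece S) {u : V N} (hu : u ∈ P.U) : P.φ u ∈ S := by
  obtain ⟨W, -, hW⟩ := P.isParam.relOpen
  exact (hW ▸ Set.mem_image_of_mem P.φ hu : P.φ u ∈ S ∩ W).1

theorem tendsto_φ (P : Piece S) {u : V N} (hu : u ∈ P.U) :
    Filter.Tendsto P.φ (𝓝 u) (𝓝[S] (P.φ u)) := by
  refine tendsto_nhdsWithin_iff.2 ⟨(P.differentiableAt_φ hu).continuousAt, ?_⟩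
  filter_upwards [P.isParam.isOpen.mem_nhds hu] with v hv using P.φ_mem hv

theorem eq_smul_ν (P : Piece S) {u : V N} (hu : u ∈ P.U) {l : V (N + 1) →ₗ[ℝ] ℝ}
    (hl : ∀ v, l (fderiv ℝ P.φ u v) = 0) : l = l (P.ξ u) • P.ν u := by
  refine LinearMap.ext fun x => ?_
  have hx : x - P.ν u x • P.ξ u ∈ tangentSpace P.φ u := by
    rw [P.mem_tangentSpace_iff hu]
    simp [P.ν_ξ hu]
  obtain ⟨v, hv⟩ := hx
  have := hl v
  rw [show fderiv ℝ P.φ u v = _ from hv] at this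
  simp only [map_sub, map_smul, smul_eq_mul] at this
  simp only [LinearMap.smul_apply, smul_eq_mul]
  linarith

end Piece

end Conormal

/-! ### Consequences of convexity -/

section Convexity

variable {N : ℕ} {S : Set (V (N + 1))}

/-- A negative second derivative would make `x` a local maximum too; then `f` is constant near `x`
and its second derivative is zero. -/
theorem _root_.IsLocalMin.deriv_deriv_nonneg {f : ℝ → ℝ} {x : ℝ} (h : IsLocalMin f x)
    (hc : ContinuousAt f x) : 0 ≤ deriv (deriv f) x := by
  by_contra! hlt
  have hmax := isLocalMax_of_deriv_deriv_neg hlt h.deriv_eq_zero hc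
  have hconst : f =ᶠ[𝓝 x] fun _ => f x := by
    filter_upwards [h, hmax] with y h₁ h₂ using le_antisymm h₂ h₁
  have := hconst.deriv.deriv_eq
  simp at this
  linarith

theorem IsConvex.isLocallyConvex (h : IsConvex S) : IsLocallyConvex S := by
  intro φ U hφ u hu
  obtain ⟨l, hl, ht, hS⟩ := h φ U hφ u hu
  exact ⟨l, hl, ht, eventually_nhdsWithin_of_forall hS⟩

/-- Local convexity makes the Blaschke metric semi-definite. -/
theorem Piece.exists_mul_h_nonneg (P : Piece S) (hS : IsLocallyConvex S) {u : V N}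
    (hu : u ∈ P.U) : ∃ s : ℝ, s ≠ 0 ∧ ∀ v, 0 ≤ s * P.h u v v := by
  obtain ⟨l, hl0, ht, hloc⟩ := hS P.φ P.U P.isParam u hu
  have hl := P.eq_smul_ν hu ht
  refine ⟨l (P.ξ u), fun h => hl0 (by rw [hl, h, zero_smul]), fun v => ?_⟩
  set L : V (N + 1) →L[ℝ] ℝ := LinearMap.toContinuousLinearMap l with hL
  have hLl : ∀ x, L x = l x := fun _ => rfl
  -- Along this line the supporting functional has a local minimum at `0`, and its second derivative
  -- there is `l(D_v D_v φ) = l(ξ) h(v, v)`.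
  set γ : ℝ → V N := fun t => u + t • v with hγ
  have hγ0 : γ 0 = u := by simp [hγ]
  have hγd : ∀ t, HasDerivAt γ v t := fun t => by
    have h := ((hasDerivAt_id t).smul_const v).const_add u
    rw [one_smul] at h
    exact h
  have hγt : Filter.Tendsto γ (𝓝 0) (𝓝 u) := by
    simpa [ContinuousAt, hγ0] using (hγd 0).continuousAt
  have hmin : IsLocalMin (fun t => L (P.φ (γ t) - P.φ u)) 0 := by
    filter_upwards [((P.tendsto_φ hu).comp hγt).eventually hloc] with t h
    simpa [hγ0, hLl] using h
  have hd : ∀ᶠ t in 𝓝 (0 : ℝ), HasDerivAt (fun t => L (P.φ (γ t) - P.φ u))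
      (L (fderiv ℝ P.φ (γ t) v)) t := by
    filter_upwards [hγt.eventually (P.isParam.isOpen.mem_nhds hu)] with t h
    exact L.hasFDerivAt.comp_hasDerivAt t
      (((P.differentiableAt_φ h).hasFDerivAt.comp_hasDerivAt t (hγd t)).sub_const _)
  have hd1 : deriv (fun t => L (P.φ (γ t) - P.φ u)) =ᶠ[𝓝 0] fun t => L (fderiv ℝ P.φ (γ t) v) :=
    hd.mono fun t h => h.deriv
  have hd2 : HasDerivAt (fun t => L (fderiv ℝ P.φ (γ t) v))
      (L (fderiv ℝ (fderiv ℝ P.φ) u v v)) 0 := by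
    have h2 := P.differentiableAt_fderiv_φ hu
    rw [← hγ0] at h2
    have := (h2.hasFDerivAt.comp_hasDerivAt 0 (hγd 0)).clm_apply (hasDerivAt_const 0 v)
    rw [hγ0] at this
    simp only [map_zero, add_zero] at this
    exact L.hasFDerivAt.comp_hasDerivAt 0 this
  have h0 := hmin.deriv_deriv_nonneg hd.self_of_nhds.continuousAt
  rw [hd1.deriv_eq, hd2.deriv, hLl, hl] at h0
  exact h0

/-- By Cauchy–Schwarz, a null vector of a semi-definite form lies in its radical. -/
theorem Piece.eq_zero_of_h_self_eq_zero (P : Piece S) (hnd : IsNondegenerate S)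
    (hS : IsLocallyConvex S) {u : V N} (hu : u ∈ P.U) {v : V N} (hv : P.h u v v = 0) : v = 0 := by
  obtain ⟨s, hs, hpos⟩ := P.exists_mul_h_nonneg hS hu
  refine hnd P.φ P.U P.isParam u hu (P.ξ u) (P.isAffineNormal.transversal u hu) v fun w => ?_
  have h := LinearMap.BilinForm.apply_mul_apply_le_of_forall_zero_le (s • P.hForm u) hpos v w
  simp only [LinearMap.smul_apply, smul_eq_mul, P.hForm_apply, hv, mul_zero, zero_mul,
    P.h_symm hu w v] at h
  have : s * P.h u v w = 0 := mul_self_eq_zero.1 (le_antisymm h (mul_self_nonneg _))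
  exact (mul_eq_zero.1 this).resolve_left hs

/-- A chord of a convex hypersurface is not contained in both tangent hyperplanes at its
end-points, when these are transversal. -/
theorem IsConvex.not_chord_tangent (hS : IsConvex S) (P₁ P₂ : Piece S) {u₁ u₂ : V N}
    (hu₁ : u₁ ∈ P₁.U) (hu₂ : u₂ ∈ P₂.U)
    (htr : tangentSpace P₁.φ u₁ ⊔ tangentSpace P₂.φ u₂ = ⊤) :
    P₁.ν u₁ (P₁.φ u₁ - P₂.φ u₂) ≠ 0 := by
  intro h
  obtain ⟨l, hl0, ht, hpos⟩ := hS P₁.φ P₁.U P₁.isParam u₁ hu₁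
  have hl := P₁.eq_smul_ν hu₁ ht
  set L : V (N + 1) →L[ℝ] ℝ := LinearMap.toContinuousLinearMap l with hL
  have hLl : ∀ x, L x = l x := fun _ => rfl
  have hzero : l (P₂.φ u₂ - P₁.φ u₁) = 0 := by
    rw [← neg_sub, map_neg, hl, LinearMap.smul_apply, h, smul_zero, neg_zero]
  -- If the chord is tangent at `p₁`, the supporting functional at `p₁` also attains its minimum `0`
  -- at `p₂`. So it vanishes on both tangent spaces, and hence everywhere by transversality.
  have hmin : IsLocalMin (fun u => L (P₂.φ u - P₁.φ u₁)) u₂ := by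
    filter_upwards [P₂.isParam.isOpen.mem_nhds hu₂] with u hu
    simpa only [hLl, hzero] using hpos _ (P₂.φ_mem hu)
  have hd : HasFDerivAt (fun u => L (P₂.φ u - P₁.φ u₁)) (L.comp (fderiv ℝ P₂.φ u₂)) u₂ :=
    L.hasFDerivAt.comp u₂ ((P₂.differentiableAt_φ hu₂).hasFDerivAt.sub_const _)
  have h0 := hmin.hasFDerivAt_eq_zero hd
  refine hl0 (LinearMap.ker_eq_top.1 (top_le_iff.1 (htr ▸ sup_le ?_ ?_)))
  · rintro _ ⟨v, rfl⟩
    exact ht v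
  · rintro _ ⟨v, rfl⟩
    exact congrArg (fun K => K v) h0

end Convexity

/-! ### Derivatives of `F` in the two points -/

section Derivatives

variable {N : ℕ} {S : Set (V (N + 1))} (P₁ P₂ : Piece S) {u₁ u₂ : V N}

/-- When `p₁` moves along `W`, `C` varies by `W/2` and `X - M` by `-W/2`. Since `ν₁(W) = 0`, these
variations contribute only through `ν₂`. -/
theorem F₁_eq (hu₁ : u₁ ∈ P₁.U) (X : V (N + 1)) (w : V N) : F₁ P₁ P₂ u₁ u₂ X w =
    1 / 2 * P₂.ν u₂ (P₁.vec u₁ w) * (P₁.ν u₁ (X - midPoint (P₁.φ u₁) (P₂.φ u₂)) -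
        P₁.ν u₁ (midChord (P₁.φ u₁) (P₂.φ u₂))) +
      P₂.ν u₂ (midChord (P₁.φ u₁) (P₂.φ u₂)) *
        P₁.dν u₁ w (X - midPoint (P₁.φ u₁) (P₂.φ u₂)) +
      P₁.dν u₁ w (midChord (P₁.φ u₁) (P₂.φ u₂)) *
        P₂.ν u₂ (X - midPoint (P₁.φ u₁) (P₂.φ u₂)) := by
  have hφ := (P₁.differentiableAt_φ hu₁).hasFDerivAt
  have hν := (P₁.differentiableAt_νL hu₁).hasFDerivAt
  have hC : HasFDerivAt (fun u => midChord (P₁.φ u) (P₂.φ u₂))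
      ((1 / 2 : ℝ) • fderiv ℝ P₁.φ u₁) u₁ := (hφ.sub_const _).const_smul (1 / 2 : ℝ)
  have hM : HasFDerivAt (fun u => X - midPoint (P₁.φ u) (P₂.φ u₂))
      (-((1 / 2 : ℝ) • fderiv ℝ P₁.φ u₁)) u₁ :=
    ((hφ.add_const _).const_smul (1 / 2 : ℝ)).const_sub X
  have h := (((P₂.νL u₂).hasFDerivAt.comp u₁ hC).mul (hν.clm_apply hM)).add
    ((hν.clm_apply hC).mul ((P₂.νL u₂).hasFDerivAt.comp u₁ hM))
  have e : F₁ P₁ P₂ u₁ u₂ X w = _ := congrArg (fun K => K w) h.fderiv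
  rw [e]
  have hv : P₁.νL u₁ (fderiv ℝ P₁.φ u₁ w) = 0 := P₁.ν_vec u₁ w
  simp [hv, Piece.dν, ← Piece.νL_apply, Piece.vec]
  ring

/-- Now both `C` and `X - M` vary by `-W/2`, whence the signs that differ from `F₁_eq`. -/
theorem F₂_eq (hu₂ : u₂ ∈ P₂.U) (X : V (N + 1)) (w : V N) : F₂ P₁ P₂ u₁ u₂ X w =
    -(1 / 2) * P₁.ν u₁ (P₂.vec u₂ w) * (P₂.ν u₂ (X - midPoint (P₁.φ u₁) (P₂.φ u₂)) +
        P₂.ν u₂ (midChord (P₁.φ u₁) (P₂.φ u₂))) +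
      P₁.ν u₁ (midChord (P₁.φ u₁) (P₂.φ u₂)) *
        P₂.dν u₂ w (X - midPoint (P₁.φ u₁) (P₂.φ u₂)) +
      P₂.dν u₂ w (midChord (P₁.φ u₁) (P₂.φ u₂)) *
        P₁.ν u₁ (X - midPoint (P₁.φ u₁) (P₂.φ u₂)) := by
  have hφ := (P₂.differentiableAt_φ hu₂).hasFDerivAt
  have hν := (P₂.differentiableAt_νL hu₂).hasFDerivAt
  have hC : HasFDerivAt (fun u => midChord (P₁.φ u₁) (P₂.φ u))
      ((1 / 2 : ℝ) • -fderiv ℝ P₂.φ u₂) u₂ := (hφ.const_sub _).const_smul (1 / 2 : ℝ)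
  have hM : HasFDerivAt (fun u => X - midPoint (P₁.φ u₁) (P₂.φ u))
      (-((1 / 2 : ℝ) • fderiv ℝ P₂.φ u₂)) u₂ :=
    ((hφ.const_add _).const_smul (1 / 2 : ℝ)).const_sub X
  have h := ((hν.clm_apply hC).mul ((P₁.νL u₁).hasFDerivAt.comp u₂ hM)).add
    (((P₁.νL u₁).hasFDerivAt.comp u₂ hC).mul (hν.clm_apply hM))
  have e : F₂ P₁ P₂ u₁ u₂ X w = _ := congrArg (fun K => K w) h.fderiv
  rw [e]
  have hv : P₂.νL u₂ (fderiv ℝ P₂.φ u₂ w) = 0 := P₂.ν_vec u₂ w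
  simp [hv, Piece.dν, ← Piece.νL_apply, Piece.vec]
  ring

end Derivatives

/-! ### Orthogonality to the intersection of the tangent spaces -/

section Frame

variable {N : ℕ} {S : Set (V (N + 1))} (P : Piece S) {u : V N} {T : Submodule ℝ (V (N + 1))}
  {ι : Type*} {z : ι → V N} {y : V N}

theorem exists_mem_span_vec_eq
    (hspan : Submodule.span ℝ (Set.range fun j => P.vec u (z j)) = tangentSpace P.φ u ⊓ T)
    {w : V (N + 1)} (hw : w ∈ tangentSpace P.φ u) (hwT : w ∈ T) :
    ∃ v ∈ Submodule.span ℝ (Set.range z), P.vec u v = w := by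
  have hm : w ∈ Submodule.span ℝ (Set.range fun j => P.vec u (z j)) := hspan ▸ ⟨hw, hwT⟩
  have hr : (Set.range fun j => P.vec u (z j)) =
      (fderiv ℝ P.φ u : V N →ₗ[ℝ] V (N + 1)) '' Set.range z := by
    rw [← Set.range_comp]; rfl
  rw [hr, Submodule.span_image] at hm
  exact hm

theorem h_eq_zero_of_mem_span (horth : ∀ j, P.h u y (z j) = 0) {v : V N}
    (hv : v ∈ Submodule.span ℝ (Set.range z)) : P.h u y v = 0 := by
  have : Submodule.span ℝ (Set.range z) ≤ LinearMap.ker (P.hForm u y) := by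
    rw [Submodule.span_le]
    rintro _ ⟨j, rfl⟩
    exact horth j
  exact this hv

/-- Otherwise `Y` would be a combination of the `Z_j`, hence orthogonal to itself, against
definiteness. -/
theorem vec_notMem (hdef : ∀ v, P.h u v v = 0 → v = 0) (hu : u ∈ P.U)
    (hspan : Submodule.span ℝ (Set.range fun j => P.vec u (z j)) = tangentSpace P.φ u ⊓ T)
    (hy : y ≠ 0) (horth : ∀ j, P.h u y (z j) = 0) : P.vec u y ∉ T := by
  intro hm
  obtain ⟨v, hv, he⟩ := exists_mem_span_vec_eq P hspan (LinearMap.mem_range_self _ y) hm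
  rw [P.vec_injective hu he] at hv
  exact hy (hdef y (h_eq_zero_of_mem_span P horth hv))

theorem dν_orth_eq_zero (hu : u ∈ P.U)
    (hspan : Submodule.span ℝ (Set.range fun j => P.vec u (z j)) = tangentSpace P.φ u ⊓ T)
    (horth : ∀ j, P.h u y (z j) = 0) {w : V (N + 1)} (hw : w ∈ tangentSpace P.φ u)
    (hwT : w ∈ T) : P.dν u y w = 0 := by
  obtain ⟨v, hv, rfl⟩ := exists_mem_span_vec_eq P hspan hw hwT
  rw [P.dν_vec hu, h_eq_zero_of_mem_span P horth hv, neg_zero]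

/-- Such a `w` is orthogonal to all `Z_j` and lies in their span, so `h(w, w) = 0`. -/
theorem eq_zero_of_dν_frame_eq_zero (hdef : ∀ v, P.h u v v = 0 → v = 0) (hu : u ∈ P.U)
    (hspan : Submodule.span ℝ (Set.range fun j => P.vec u (z j)) = tangentSpace P.φ u ⊓ T)
    {w : V (N + 1)} (hw : w ∈ tangentSpace P.φ u) (hwT : w ∈ T)
    (h : ∀ j, P.dν u (z j) w = 0) : w = 0 := by
  obtain ⟨v, hv, rfl⟩ := exists_mem_span_vec_eq P hspan hw hwT
  have hz : ∀ j, P.h u v (z j) = 0 := fun j => by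
    rw [P.h_symm hu]
    simpa [P.dν_vec hu] using h j
  rw [hdef v (h_eq_zero_of_mem_span P hz hv)]
  exact map_zero (fderiv ℝ P.φ u)

/-- A linear functional on the parameter space vanishes if it vanishes on `y` and on the `z j`. -/
theorem eq_zero_of_frame {ν : V (N + 1) →ₗ[ℝ] ℝ} (hu : u ∈ P.U)
    (hspan : Submodule.span ℝ (Set.range fun j => P.vec u (z j)) =
      tangentSpace P.φ u ⊓ LinearMap.ker ν)
    (hy : ν (P.vec u y) ≠ 0) {f : V N →ₗ[ℝ] ℝ} (hfy : f y = 0) (hfz : ∀ j, f (z j) = 0)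
    (w : V N) : f w = 0 := by
  -- Subtracting this multiple of `y` moves the tangent vector into the kernel of `ν`, where the
  -- `Z_j` span.
  have hsub : P.vec u (w - (ν (P.vec u w) / ν (P.vec u y)) • y) =
      P.vec u w - (ν (P.vec u w) / ν (P.vec u y)) • P.vec u y := by simp [Piece.vec]
  obtain ⟨v, hv, he⟩ := exists_mem_span_vec_eq P hspan
    (LinearMap.mem_range_self _ (w - (ν (P.vec u w) / ν (P.vec u y)) • y))
    (show _ ∈ LinearMap.ker ν by
      rw [LinearMap.mem_ker]
      exact (congrArg ν hsub).trans (by simp [hy]))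
  have hle : Submodule.span ℝ (Set.range z) ≤ LinearMap.ker f := by
    rw [Submodule.span_le]
    rintro _ ⟨j, rfl⟩
    exact hfz j
  have := hle (P.vec_injective hu he ▸ hv)
  simpa [hfy] using this

end Frame

end EMH

end

/-! ### Reduction to the linear system, and conclusion -/

open EMH
theorem mainTheorem1 {N : ℕ} (S : Set (V (N + 1)))
    (hS : IsHypersurface S) (hnd : IsNondegenerate S)
    (P₁ P₂ : Piece S) (u₁ u₂ : V N) (hu₁ : u₁ ∈ P₁.U) (hu₂ : u₂ ∈ P₂.U)
    -- the tangent spaces at `p₁ = φ₁(u₁)` and `p₂ = φ₂(u₂)` are transversal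
    (htr : tangentSpace P₁.φ u₁ ⊔ tangentSpace P₂.φ u₂ = ⊤)
    -- `S` is convex; or it is only locally convex, and `M` is not in both tangent hyperplanes
    (hconv : IsConvex S ∨ (IsLocallyConvex S ∧
      ¬ (midPoint (P₁.φ u₁) (P₂.φ u₂) - P₁.φ u₁ ∈ tangentSpace P₁.φ u₁ ∧
        midPoint (P₁.φ u₁) (P₂.φ u₂) - P₂.φ u₂ ∈ tangentSpace P₂.φ u₂)))
    -- a frame `Z_j` of the intersection of the tangent spaces
    (z₁ z₂ : Fin (N - 1) → V N)
    (hz : ∀ j, P₁.vec u₁ (z₁ j) = P₂.vec u₂ (z₂ j))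
    (hzli : LinearIndependent ℝ (fun j => P₁.vec u₁ (z₁ j)))
    (hzspan : Submodule.span ℝ (Set.range fun j => P₁.vec u₁ (z₁ j)) =
      tangentSpace P₁.φ u₁ ⊓ tangentSpace P₂.φ u₂)
    -- non-zero tangent vectors `Yᵢ` that are `hᵢ`-orthogonal to it
    (y₁ y₂ : V N) (hy₁ : y₁ ≠ 0) (hy₂ : y₂ ≠ 0)
    (horth₁ : ∀ j, P₁.h u₁ y₁ (z₁ j) = 0) (horth₂ : ∀ j, P₂.h u₂ y₂ (z₂ j) = 0) :
    let Y₁ := P₁.vec u₁ y₁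
    let Y₂ := P₂.vec u₂ y₂
    let M := midPoint (P₁.φ u₁) (P₂.φ u₂)
    let C := midChord (P₁.φ u₁) (P₂.φ u₂)
    let ν₁ := P₁.ν u₁
    let ν₂ := P₂.ν u₂
    let l := lam P₁ P₂ u₁ u₂ y₁ y₂
    let κ := kap P₁ P₂ u₁ u₂ y₁ y₂
    let b := coeffB P₁ P₂ u₁ u₂ y₁
    let Sol := IsSolution P₁ P₂ u₁ u₂ y₁ y₂ z₁ z₂
    -- the system says that `F = 0`, `F_{p₁} = 0` and `F_{p₂} = 0`
    (∀ X, Sol X ↔ F P₁ P₂ u₁ u₂ X = 0 ∧ (∀ w, F₁ P₁ P₂ u₁ u₂ X w = 0) ∧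
      ∀ w, F₂ P₁ P₂ u₁ u₂ X w = 0) ∧
    -- the two conditions determine the number `A`
    (C ∈ Submodule.span ℝ {Y₁, Y₂} ∧ ν₁ C = -l * ν₂ C → ∃! A : ℝ, C = A • (Y₁ - κ • Y₂)) ∧
    -- existence of a solution
    ((∃ X, Sol X) ↔ C ∈ Submodule.span ℝ {Y₁, Y₂} ∧ ν₁ C = -l * ν₂ C ∧
      ∃ A : ℝ, C = A • (Y₁ - κ • Y₂) ∧ l + 4 * A * b ≠ 0) ∧
    -- the solution
    (∀ A : ℝ, C = A • (Y₁ - κ • Y₂) → ∀ X, Sol X ↔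
      l + 4 * A * b ≠ 0 ∧ X - M = (-(l * A) / (l + 4 * A * b)) • (Y₁ + κ • Y₂)) := by
  simp only
  have hloc : IsLocallyConvex S := hconv.elim IsConvex.isLocallyConvex And.left
  have hdef₁ : ∀ v, P₁.h u₁ v v = 0 → v = 0 := fun v =>
    P₁.eq_zero_of_h_self_eq_zero hnd hloc hu₁
  have hdef₂ : ∀ v, P₂.h u₂ v v = 0 → v = 0 := fun v =>
    P₂.eq_zero_of_h_self_eq_zero hnd hloc hu₂
  have hT₁ : tangentSpace P₁.φ u₁ = LinearMap.ker (P₁.ν u₁) :=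
    Submodule.ext (P₁.mem_tangentSpace_iff hu₁)
  have hT₂ : tangentSpace P₂.φ u₂ = LinearMap.ker (P₂.ν u₂) :=
    Submodule.ext (P₂.mem_tangentSpace_iff hu₂)
  have hs₁ : Submodule.span ℝ (Set.range fun j => P₁.vec u₁ (z₁ j)) =
      tangentSpace P₁.φ u₁ ⊓ LinearMap.ker (P₂.ν u₂) := by rw [hzspan, hT₂]
  have hs₂ : Submodule.span ℝ (Set.range fun j => P₂.vec u₂ (z₂ j)) =
      tangentSpace P₂.φ u₂ ⊓ LinearMap.ker (P₁.ν u₁) := by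
    simp_rw [← hz]
    rw [hzspan, hT₁, inf_comm]
  have hm : P₂.ν u₂ (P₁.vec u₁ y₁) ≠ 0 := vec_notMem P₁ hdef₁ hu₁ hs₁ hy₁ horth₁
  have hn : P₁.ν u₁ (P₂.vec u₂ y₂) ≠ 0 := vec_notMem P₂ hdef₂ hu₂ hs₂ hy₂ horth₂
  have h₁ := P₁.ν_vec u₁ y₁
  have h₂ := P₂.ν_vec u₂ y₂
  -- In the locally convex case this is the assumption on `M`, because `M - p₁ = -C` and `M - p₂ =
  -- C`.
  have hC : ¬ (P₁.ν u₁ (midChord (P₁.φ u₁) (P₂.φ u₂)) = 0 ∧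
      P₂.ν u₂ (midChord (P₁.φ u₁) (P₂.φ u₂)) = 0) := by
    rintro ⟨k₁, k₂⟩
    rcases hconv with hconv | ⟨-, hM⟩
    · refine hconv.not_chord_tangent P₁ P₂ hu₁ hu₂ htr ?_
      simpa [midChord] using k₁
    · refine hM ⟨?_, ?_⟩
      · rw [hT₁, LinearMap.mem_ker, show midPoint (P₁.φ u₁) (P₂.φ u₂) - P₁.φ u₁ =
          -midChord (P₁.φ u₁) (P₂.φ u₂) by unfold midPoint midChord; module, map_neg, k₁,
          neg_zero]
      · rw [hT₂, LinearMap.mem_ker, show midPoint (P₁.φ u₁) (P₂.φ u₂) - P₂.φ u₂ =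
          midChord (P₁.φ u₁) (P₂.φ u₂) by unfold midPoint midChord; module, k₂]
  have hd₁ : ∀ w, P₁.ν u₁ w = 0 → P₂.ν u₂ w = 0 → P₁.dν u₁ y₁ w = 0 := fun w hw hw' =>
    dν_orth_eq_zero P₁ hu₁ hs₁ horth₁ ((P₁.mem_tangentSpace_iff hu₁ w).2 hw) hw'
  have hd₂ : ∀ w, P₁.ν u₁ w = 0 → P₂.ν u₂ w = 0 → P₂.dν u₂ y₂ w = 0 := fun w hw hw' =>
    dν_orth_eq_zero P₂ hu₂ hs₂ horth₂ ((P₂.mem_tangentSpace_iff hu₂ w).2 hw') hw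
  have he₁ : ∀ j, P₁.dν u₁ (z₁ j) (P₁.vec u₁ y₁) = 0 := fun j => by
    rw [P₁.dν_vec hu₁, P₁.h_symm hu₁, horth₁, neg_zero]
  have he₂ : ∀ j, P₂.dν u₂ (z₂ j) (P₂.vec u₂ y₂) = 0 := fun j => by
    rw [P₂.dν_vec hu₂, P₂.h_symm hu₂, horth₂, neg_zero]
  have hw₁ : ∀ w, P₁.ν u₁ w = 0 → P₂.ν u₂ w = 0 → (∀ j, P₁.dν u₁ (z₁ j) w = 0) → w = 0 :=
    fun w hw hw' => eq_zero_of_dν_frame_eq_zero P₁ hdef₁ hu₁ hs₁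
      ((P₁.mem_tangentSpace_iff hu₁ w).2 hw) hw'
  have hw₂ : ∀ w, P₁.ν u₁ w = 0 → P₂.ν u₂ w = 0 → (∀ j, P₂.dν u₂ (z₂ j) w = 0) → w = 0 :=
    fun w hw hw' => eq_zero_of_dν_frame_eq_zero P₂ hdef₂ hu₂ hs₂
      ((P₂.mem_tangentSpace_iff hu₂ w).2 hw') hw
  have hH₁ : P₁.h u₁ y₁ y₁ ≠ 0 := fun h => hy₁ (hdef₁ y₁ h)
  have hH₂ : P₂.h u₂ y₂ y₂ ≠ 0 := fun h => hy₂ (hdef₂ y₂ h)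
  have hl := cbrt_pow_three ((P₁.ν u₁ (P₂.vec u₂ y₂)) ^ 2 / (P₂.ν u₂ (P₁.vec u₁ y₁)) ^ 2 *
    (P₁.h u₁ y₁ y₁ / P₂.h u₂ y₂ y₂))
  have hsys : ∀ X, IsSolution P₁ P₂ u₁ u₂ y₁ y₂ z₁ z₂ X ↔
      LinSystem (P₁.ν u₁) (P₂.ν u₂) (P₁.dν u₁ y₁) (P₂.dν u₂ y₂) (fun j => P₁.dν u₁ (z₁ j))
        (fun j => P₂.dν u₂ (z₂ j)) (P₁.vec u₁ y₁) (P₂.vec u₂ y₂)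
        (midChord (P₁.φ u₁) (P₂.φ u₂)) (X - midPoint (P₁.φ u₁) (P₂.φ u₂)) := by
    intro X
    -- `Z_j` is tangent to both pieces, so the terms with factor `1/2` drop out of its equations.
    have a₁ : ∀ j, P₂.ν u₂ (P₁.vec u₁ (z₁ j)) = 0 := fun j => by rw [hz, P₂.ν_vec]
    have a₂ : ∀ j, P₁.ν u₁ (P₂.vec u₂ (z₂ j)) = 0 := fun j => by rw [← hz, P₁.ν_vec]
    constructor
    · rintro ⟨f₀, f₁, f₂, g₁, g₂⟩
      simp only [F₁_eq P₁ P₂ hu₁, F₂_eq P₁ P₂ hu₂, a₁, a₂, mul_zero, zero_mul, zero_add]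
        at f₁ f₂ g₁ g₂
      exact ⟨f₀, f₁, f₂, g₁, g₂⟩
    · rintro ⟨f₀, f₁, f₂, g₁, g₂⟩
      refine ⟨f₀, ?_, ?_, ?_, ?_⟩ <;> simp only [F₁_eq P₁ P₂ hu₁, F₂_eq P₁ P₂ hu₂, a₁, a₂,
        mul_zero, zero_mul, zero_add]
      exacts [f₁, f₂, g₁, g₂]
  have hex : midChord (P₁.φ u₁) (P₂.φ u₂) ∈
        Submodule.span ℝ {P₁.vec u₁ y₁, P₂.vec u₂ y₂} ∧
      P₁.ν u₁ (midChord (P₁.φ u₁) (P₂.φ u₂)) =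
        -lam P₁ P₂ u₁ u₂ y₁ y₂ * P₂.ν u₂ (midChord (P₁.φ u₁) (P₂.φ u₂)) →
      ∃! A : ℝ, midChord (P₁.φ u₁) (P₂.φ u₂) =
        A • (P₁.vec u₁ y₁ - kap P₁ P₂ u₁ u₂ y₁ y₂ • P₂.vec u₂ y₂) := fun h =>
    existsUnique_coord h₁ h₂ hm hn h.1 h.2
  have hsol : ∀ A : ℝ, midChord (P₁.φ u₁) (P₂.φ u₂) =
        A • (P₁.vec u₁ y₁ - kap P₁ P₂ u₁ u₂ y₁ y₂ • P₂.vec u₂ y₂) → ∀ X,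
      IsSolution P₁ P₂ u₁ u₂ y₁ y₂ z₁ z₂ X ↔
        lam P₁ P₂ u₁ u₂ y₁ y₂ + 4 * A * coeffB P₁ P₂ u₁ u₂ y₁ ≠ 0 ∧
        X - midPoint (P₁.φ u₁) (P₂.φ u₂) = (-(lam P₁ P₂ u₁ u₂ y₁ y₂ * A) /
            (lam P₁ P₂ u₁ u₂ y₁ y₂ + 4 * A * coeffB P₁ P₂ u₁ u₂ y₁)) •
          (P₁.vec u₁ y₁ + kap P₁ P₂ u₁ u₂ y₁ y₂ • P₂.vec u₂ y₂) := fun A hA X =>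
    (hsys X).trans (linSystem_solution h₁ h₂ hm hn hd₁ hd₂ he₁ he₂ hw₁ hw₂
      (P₁.dν_vec hu₁ y₁ y₁) (P₂.dν_vec hu₂ y₂ y₂) hH₁ hH₂ hl hC hA _)
  refine ⟨fun X => ⟨fun h => ⟨h.eq_zero, ?_, ?_⟩, fun h => ⟨h.1, h.2.1 _, h.2.2 _,
    fun _ => h.2.1 _, fun _ => h.2.2 _⟩⟩, hex, ⟨?_, ?_⟩, hsol⟩
  · exact eq_zero_of_frame P₁ hu₁ hs₁ hm
      (f := (fderiv ℝ (fun u => F P₁ P₂ u u₂ X) u₁ : V N →ₗ[ℝ] ℝ)) h.eq_Y₁ h.eq_Z₁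
  · exact eq_zero_of_frame P₂ hu₂ hs₂ hn
      (f := (fderiv ℝ (fun u => F P₁ P₂ u₁ u X) u₂ : V N →ₗ[ℝ] ℝ)) h.eq_Y₂ h.eq_Z₂
  · rintro ⟨X, hX⟩
    have hnec := linSystem_necessary h₁ h₂ hm hn hd₁ hd₂ he₁ he₂ hw₁ hw₂
      (P₁.dν_vec hu₁ y₁ y₁) (P₂.dν_vec hu₂ y₂ y₂) hH₁ hH₂ hl hC ((hsys X).1 hX)
    obtain ⟨A, hA, -⟩ := hex hnec
    exact ⟨hnec.1, hnec.2, A, hA, ((hsol A hA X).1 hX).1⟩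
  · rintro ⟨-, -, A, hA, hne⟩
    -- Unification fills the `_` with the vector that `hsol` prescribes for `X - M`.
    exact ⟨midPoint (P₁.φ u₁) (P₂.φ u₂) + _, (hsol A hA _).2 ⟨hne, add_sub_cancel_left _ _⟩⟩
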